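/- A Dyck path is a word $w$ in the letters $u,d$, with equally many $u$'s and $d$'s, no initial segment of which contains more $d$'s than $u$'s; $l(w)$ denotes its length. Let $T_p(w)$ be the planar rooted tree with $l(w)/2$ edges associated to $w$ by the standard bijection: the depth-first walk around $T_p(w)$, from left to right and starting at the root, writes $w$ when each step away from the root is recorded as $u$ and each step back towards the root as $d$. A leaf of $T_p(w)$ is a vertex of degree one (the root is a leaf if it has degree one). A subtree of $T_p(w)$ is a nonempty connected subgraph; it need not contain the root of $T_p(w)$, and it is itself a planar rooted tree, with its vertex closest to the root of $T_p(w)$ as its root and with the induced orderings. For an integer $l\ge 2$ and a Dyck path $w$ put $$s_l(w)=\begin{cases}\#\{\text{subtrees of }T_p(w)\} & \text{if } T_p(w) \text{ has at most } l \text{ leaves},\\ 0 & \text{otherwise.}\end{cases}$$ **Theorem.** Let $l\ge 2$ be fixed. Then the generating function $$H_l(t)=\sum_{w} s_l(w)\,t^{l(w)/2}\in\mathbb{Q}[[t]],$$ where the sum is over all Dyck paths $w$ (including the empty one), is algebraic; that is, it satisfies a nonzero polynomial equation with coefficients in $\mathbb{Q}(t)$ (equivalently, in $\mathbb{Q}[t]$).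 -/

import Mathlib

/-- A planar rooted tree, described by the ordered list of the planar rooted trees that hang off
its root. The tree `node []` is a single vertex. -/
inductive PlanarTree : Type
  | node (children : List PlanarTree) : PlanarTree

namespace PlanarTree

/-- The trees hanging off the root, in their given order. -/
def children : PlanarTree → List PlanarTree
  | node ts => ts

/-- The part of `t` above the vertex with address `a`, or `none` if there is no such vertex.
The address of a vertex records which edge (counted from the left, starting with `0`) is taken
at each step of the path from the root to that vertex. -/
def above : PlanarTree → List ℕ → Option PlanarTree
  | t, [] => some t
  | t, i :: a => (t.children[i]?).bind fun c => c.above a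

/-- The vertices of `t`, given by their addresses; the root is the empty address. -/
def Vertex (t : PlanarTree) : Type := {a : List ℕ // (t.above a).isSome = true}

/-- The tree underlying `t`, as a graph: its edges join each vertex to its children. -/
def graph (t : PlanarTree) : SimpleGraph t.Vertex where
  Adj v w := (∃ i : ℕ, w.1 = v.1 ++ [i]) ∨ (∃ i : ℕ, v.1 = w.1 ++ [i])
  symm := ⟨fun _ _ h => h.symm⟩
  loopless := ⟨fun v h => by
    rcases h with ⟨i, h⟩ | ⟨i, h⟩ <;> simpa using congrArg List.length h⟩

/-- The number of leaves of `t`, that is, of vertices of degree one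
(the root counts as a leaf if it has degree one). -/
noncomputable def numLeaves (t : PlanarTree) : ℕ :=
  {v : t.Vertex | (t.graph.neighborSet v).ncard = 1}.ncard

/-- The number of subtrees of `t`, that is, of subgraphs that are trees. A subtree need not
contain the root of `t`; it is a planar rooted tree in one way, its root being its vertex closest
to the root of `t` and its orderings being those of `t`. -/
noncomputable def numSubtrees (t : PlanarTree) : ℕ :=
  Nat.card {S : t.graph.Subgraph // S.coe.IsTree}

/-- The word written by the depth-first walk around `t`, from left to right: `U` for each step
away from the root and `D` for each step back. -/
def contour : PlanarTree → List DyckStep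
  | node [] => []
  | node (c :: ts) => DyckStep.U :: (contour c ++ DyckStep.D :: contour (node ts))

end PlanarTree

namespace DyckWord

/-- The planar rooted tree `T_p(w)` of a Dyck path `w`. The empty path gives a single vertex; if
`w = u a d b` with `a`, `b` Dyck paths, then the leftmost edge at the root leads to the tree of
`a`, and the remaining edges at the root are those of the tree of `b`. -/
def planarTree (w : DyckWord) : PlanarTree :=
  if h : w = 0 then .node []
  else
    have := semilength_insidePart_lt h
    have := semilength_outsidePart_lt h
    .node (w.insidePart.planarTree :: w.outsidePart.planarTree.children)
termination_by w.semilength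

/-- The depth-first walk around `T_p(w)` reads the word `w`. -/
theorem contour_planarTree (w : DyckWord) : w.planarTree.contour = w.toList := by
  induction hn : w.semilength using Nat.strong_induction_on generalizing w with
  | _ n ih =>
    subst hn
    rw [planarTree]
    split_ifs with h
    · subst h; simp [PlanarTree.contour]; rfl
    · have h1 := ih _ (semilength_insidePart_lt h) _ rfl
      have h2 := ih _ (semilength_outsidePart_lt h) _ rfl
      have h3 : PlanarTree.node w.outsidePart.planarTree.children = w.outsidePart.planarTree := by
        cases w.outsidePart.planarTree; rfl
      rw [PlanarTree.contour, h3, h1, h2]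
      conv_rhs => rw [← nest_insidePart_add_outsidePart h]
      change _ = (w.insidePart.nest).toList ++ w.outsidePart.toList
      simp [nest]

/-- The invariant `s_l(w)`: the number of subtrees of `T_p(w)` if this tree has at most `l`
leaves, and `0` otherwise. -/
noncomputable def subtreeCount (l : ℕ) (w : DyckWord) : ℕ :=
  if w.planarTree.numLeaves ≤ l then w.planarTree.numSubtrees else 0

/-- The generating function `H_l(t) = ∑ s_l(w) t ^ (l(w) / 2)`, summed over all Dyck paths `w`.
Half the length of `w` is `w.semilength`, and there are finitely many `w` for each value of it. -/
noncomputable def subtreeSeries (l : ℕ) : PowerSeries ℚ :=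
  PowerSeries.mk fun n => ∑ w : {w : DyckWord // w.semilength = n}, (subtreeCount l w.1 : ℚ)

end DyckWord

/-! ### Vertex addresses and the attachment of a leftmost branch -/

namespace PlanarTree

open Set

/-! Cut a nonempty Dyck path at its first return, `w = u a d b`; on trees this attaches the tree of
`a` as a new leftmost branch to the tree of `b`. With `R` and `U` the numbers of subtrees with and
without the root, `R(w) = (1 + R(a)) R(b)` and `U(w) = R(a) + U(a) + U(b)`. The number of non-root
leaves is additive too, except that an empty `a` contributes one leaf.

Fix the number `k > 0` of non-root leaves. Since the branch always carries at least one leaf, `b`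
has fewer than `k`, and a nonempty `a` has exactly `k` only when `b` is empty. So if `F_k` is the
series at level `k` of the weight `1`, `R` or `U`, then `(1 - t) F_k` is a polynomial expression in
`t`, lower levels and, for `R` and `U`, level `k` of a weight already treated. Strong induction on
`k` gives algebraicity (`genFun_level_firstReturnConv_sub_mem`, `genFun_level_mem`).

`H_l` is the sum of the levels `k ≤ l` of `R + U`, corrected for trees whose root is itself a leaf
(`subtreeCount_eq`). Subgraphs are counted through their sets of addresses (`numSubtrees_eq`). -/

@[elab_as_elim]
theorem nodeInduction {motive : PlanarTree → Prop} (nil : motive (node []))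
    (cons : ∀ c ts, motive c → motive (node ts) → motive (node (c :: ts))) :
    ∀ t, motive t
  | node [] => nil
  | node (c :: ts) => cons c ts (nodeInduction nil cons c) (nodeInduction nil cons (node ts))

/-- The addresses of the vertices of `t`. -/
def addresses (t : PlanarTree) : Set (List ℕ) := {a | (t.above a).isSome = true}

/-- The address that a vertex gets when a new leftmost edge is attached to the root. -/
def shift : List ℕ → List ℕ
  | [] => []
  | i :: a => (i + 1) :: a

theorem shift_injective : Function.Injective shift := by
  rintro (_ | ⟨i, a⟩) (_ | ⟨j, b⟩) h <;> simp_all [shift]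

@[simp] theorem shift_nil : shift [] = [] := rfl

@[simp] theorem shift_eq_nil {a : List ℕ} : shift a = [] ↔ a = [] := by
  cases a <;> simp [shift]

@[simp] theorem shift_ne_zero_cons (a b : List ℕ) : shift a ≠ 0 :: b := by
  cases a <;> simp [shift]

@[simp] theorem zero_cons_ne_shift (a b : List ℕ) : 0 :: b ≠ shift a := by
  cases a <;> simp [shift]

/-- The root counts as a shifted address, so it belongs to the `node ts` side of every later
splitting. -/
theorem eq_zero_cons_or_eq_shift (a : List ℕ) : (∃ b, a = 0 :: b) ∨ ∃ b, a = shift b := by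
  rcases a with _ | ⟨_ | i, a⟩
  · exact .inr ⟨[], rfl⟩
  · exact .inl ⟨a, rfl⟩
  · exact .inr ⟨i :: a, rfl⟩

theorem forall_address {p : List ℕ → Prop} :
    (∀ a, p a) ↔ (∀ a, p (0 :: a)) ∧ ∀ a, p (shift a) := by
  refine ⟨fun h => ⟨fun a => h _, fun a => h _⟩, fun h a => ?_⟩
  rcases eq_zero_cons_or_eq_shift a with ⟨b, rfl⟩ | ⟨b, rfl⟩
  · exact h.1 b
  · exact h.2 b

@[simp] theorem shift_prefix_shift {a b : List ℕ} : shift a <+: shift b ↔ a <+: b := by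
  cases a <;> cases b <;> simp [shift, List.cons_prefix_cons]

@[simp] theorem not_zero_cons_prefix_shift (a b : List ℕ) : ¬ 0 :: a <+: shift b := by
  cases b <;> simp [shift, List.cons_prefix_cons]

@[simp] theorem shift_prefix_zero_cons {a b : List ℕ} : shift a <+: 0 :: b ↔ a = [] := by
  cases a <;> simp [shift, List.cons_prefix_cons]

@[simp] theorem above_nil (t : PlanarTree) : t.above [] = some t := by
  cases t; simp [above]

@[simp] theorem above_zero_cons (c : PlanarTree) (ts : List PlanarTree) (a : List ℕ) :
    (node (c :: ts)).above (0 :: a) = c.above a := by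
  simp [above, children]

theorem above_shift (c : PlanarTree) (ts : List PlanarTree) {a : List ℕ} (h : a ≠ []) :
    (node (c :: ts)).above (shift a) = (node ts).above a := by
  cases a with
  | nil => exact absurd rfl h
  | cons i a => simp [shift, above, children]

@[simp] theorem nil_mem_addresses (t : PlanarTree) : [] ∈ t.addresses := by
  simp [addresses]

@[simp] theorem zero_cons_mem_addresses {c : PlanarTree} {ts : List PlanarTree} {a : List ℕ} :
    0 :: a ∈ (node (c :: ts)).addresses ↔ a ∈ c.addresses := by
  simp [addresses]

@[simp] theorem shift_mem_addresses {c : PlanarTree} {ts : List PlanarTree} {a : List ℕ} :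
    shift a ∈ (node (c :: ts)).addresses ↔ a ∈ (node ts).addresses := by
  by_cases h : a = []
  · simp [h]
  · simp [addresses, above_shift c ts h]

theorem addresses_node_nil : (node []).addresses = {[]} := by
  ext a
  cases a <;> simp [addresses, above, children]

/-- The set of addresses in `node (c :: ts)` made from one in `c` and one in `node ts`. -/
def graft (p : Set (List ℕ) × Set (List ℕ)) : Set (List ℕ) := List.cons 0 '' p.1 ∪ shift '' p.2

@[simp] theorem zero_cons_mem_graft {p : Set (List ℕ) × Set (List ℕ)} {a : List ℕ} :
    0 :: a ∈ graft p ↔ a ∈ p.1 := by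
  simp [graft]

@[simp] theorem shift_mem_graft {p : Set (List ℕ) × Set (List ℕ)} {a : List ℕ} :
    shift a ∈ graft p ↔ a ∈ p.2 := by
  simp [graft, shift_injective.eq_iff, eq_comm]

@[simp] theorem nil_mem_graft {p : Set (List ℕ) × Set (List ℕ)} : [] ∈ graft p ↔ [] ∈ p.2 :=
  shift_mem_graft (a := [])

theorem graft_preimage (S : Set (List ℕ)) : graft (List.cons 0 ⁻¹' S, shift ⁻¹' S) = S := by
  ext a
  revert a
  rw [forall_address]
  simp

theorem graft_injective : Function.Injective graft := by
  intro p q h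
  ext a
  · rw [← zero_cons_mem_graft, h, zero_cons_mem_graft]
  · rw [← shift_mem_graft, h, shift_mem_graft]

theorem addresses_node_cons (c : PlanarTree) (ts : List PlanarTree) :
    (node (c :: ts)).addresses = graft (c.addresses, (node ts).addresses) := by
  ext a
  revert a
  rw [forall_address]
  simp

theorem finite_addresses (t : PlanarTree) : t.addresses.Finite := by
  induction t using nodeInduction with
  | nil => simp [addresses_node_nil]
  | cons c ts hc hts =>
    rw [addresses_node_cons]
    exact (hc.image _).union (hts.image _)

/-! ### Recursions for the numbers of rooted and unrooted subtrees -/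

/-- The vertex sets of the subtrees of `t` that contain the root. -/
def rootedSets (t : PlanarTree) : Set (Set (List ℕ)) :=
  {S | [] ∈ S ∧ S ⊆ t.addresses ∧ ∀ a ∈ S, ∀ b, b <+: a → b ∈ S}

/-- The vertex sets of the subtrees of `t`. -/
def connectedSets (t : PlanarTree) : Set (Set (List ℕ)) :=
  {S | S ⊆ t.addresses ∧ ∃ r ∈ S, ∀ a ∈ S, r <+: a ∧ ∀ b, r <+: b → b <+: a → b ∈ S}

/-- The vertex sets of the subtrees of `t` that do not contain the root. -/
def unrootedSets (t : PlanarTree) : Set (Set (List ℕ)) := {S ∈ t.connectedSets | [] ∉ S}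

theorem finite_connectedSets (t : PlanarTree) : t.connectedSets.Finite :=
  t.finite_addresses.finite_subsets.subset fun _ h => h.1

theorem connectedSets_eq (t : PlanarTree) :
    t.connectedSets = t.rootedSets ∪ t.unrootedSets := by
  ext S
  constructor
  · intro h
    by_cases h0 : [] ∈ S
    · obtain ⟨h1, r, hr, h2⟩ := h
      obtain rfl : r = [] := List.prefix_nil.1 (h2 _ h0).1
      exact .inl ⟨h0, h1, fun a ha b hb => (h2 a ha).2 b List.nil_prefix hb⟩
    · exact .inr ⟨h, h0⟩
  · rintro (⟨h0, h1, h2⟩ | h)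
    · exact ⟨h1, [], h0, fun a ha => ⟨List.nil_prefix, fun b _ hb => h2 a ha b hb⟩⟩
    · exact h.1

theorem finite_rootedSets (t : PlanarTree) : t.rootedSets.Finite :=
  t.finite_connectedSets.subset (by rw [connectedSets_eq]; exact subset_union_left)

theorem finite_unrootedSets (t : PlanarTree) : t.unrootedSets.Finite :=
  t.finite_connectedSets.subset fun _ h => h.1

theorem ncard_connectedSets (t : PlanarTree) :
    t.connectedSets.ncard = t.rootedSets.ncard + t.unrootedSets.ncard := by
  rw [connectedSets_eq, ncard_union_eq _ t.finite_rootedSets t.finite_unrootedSets]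
  exact disjoint_left.2 fun S h h' => h'.2 h.1

theorem ncard_rootedSets_nil : (node []).rootedSets.ncard = 1 := by
  rw [ncard_eq_one]
  refine ⟨{[]}, ?_⟩
  ext S
  simp only [rootedSets, addresses_node_nil, mem_ofPred_eq, mem_singleton_iff]
  constructor
  · rintro ⟨h0, h1, -⟩
    exact h1.antisymm (by simpa using h0)
  · rintro rfl
    simp

theorem unrootedSets_nil : (node []).unrootedSets = ∅ := by
  ext S
  simp only [unrootedSets, connectedSets, addresses_node_nil, mem_ofPred_eq, mem_empty_iff_false,
    iff_false]
  rintro ⟨⟨h1, r, hr, -⟩, h0⟩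
  obtain rfl : r = [] := h1 hr
  exact h0 hr

/-- The part inside the new branch may be empty; otherwise prefix-closure forces it to contain the
root of `c`. The two parts are chosen independently. -/
theorem graft_mem_rootedSets {c : PlanarTree} {ts : List PlanarTree}
    {p : Set (List ℕ) × Set (List ℕ)} :
    graft p ∈ (node (c :: ts)).rootedSets ↔
      p ∈ insert ∅ c.rootedSets ×ˢ (node ts).rootedSets := by
  obtain ⟨A, B⟩ := p
  constructor
  · rintro ⟨h0, h1, h2⟩
    have h3 : ∀ a ∈ A, ∀ b, b <+: a → b ∈ A := fun a ha b hb => zero_cons_mem_graft.1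
      (h2 (0 :: a) (zero_cons_mem_graft.2 ha) (0 :: b) (by simpa [List.cons_prefix_cons] using hb))
    refine ⟨?_, nil_mem_graft.1 h0, fun b hb => ?_, fun a ha b hb => ?_⟩
    · rcases A.eq_empty_or_nonempty with rfl | ⟨a, ha⟩
      · exact .inl rfl
      · exact .inr ⟨h3 a ha [] List.nil_prefix, fun a ha => zero_cons_mem_addresses.1
          (h1 (zero_cons_mem_graft.2 ha)), h3⟩
    · exact shift_mem_addresses.1 (h1 (shift_mem_graft.2 hb))
    · exact shift_mem_graft.1 (h2 _ (shift_mem_graft.2 ha) _ (shift_prefix_shift.2 hb))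
  · rintro ⟨hA, h0, hB, hB'⟩
    have hA1 : A ⊆ c.addresses := by
      rcases hA with rfl | hA
      · exact empty_subset _
      · exact hA.2.1
    have hA2 : ∀ a ∈ A, ∀ b, b <+: a → b ∈ A := by
      rcases hA with rfl | hA
      · exact fun a ha => ha.elim
      · exact hA.2.2
    refine ⟨nil_mem_graft.2 h0, ?_, ?_⟩
    · rintro _ (⟨a, ha, rfl⟩ | ⟨b, hb, rfl⟩)
      · exact zero_cons_mem_addresses.2 (hA1 ha)
      · exact shift_mem_addresses.2 (hB hb)
    · rintro _ (⟨a, ha, rfl⟩ | ⟨b, hb, rfl⟩) x hx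
      · rcases eq_zero_cons_or_eq_shift x with ⟨x, rfl⟩ | ⟨x, rfl⟩
        · exact zero_cons_mem_graft.2 (hA2 a ha x (by simpa [List.cons_prefix_cons] using hx))
        · rw [shift_prefix_zero_cons] at hx
          subst hx
          exact nil_mem_graft.2 h0
      · rcases eq_zero_cons_or_eq_shift x with ⟨x, rfl⟩ | ⟨x, rfl⟩
        · exact absurd hx (not_zero_cons_prefix_shift _ _)
        · exact shift_mem_graft.2 (hB' b hb x (shift_prefix_shift.1 hx))

theorem ncard_rootedSets_cons (c : PlanarTree) (ts : List PlanarTree) :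
    (node (c :: ts)).rootedSets.ncard =
      (1 + c.rootedSets.ncard) * (node ts).rootedSets.ncard := by
  have h : (node (c :: ts)).rootedSets =
      graft '' (insert ∅ c.rootedSets ×ˢ (node ts).rootedSets) := by
    ext S
    rw [← graft_preimage S, graft_mem_rootedSets, graft_injective.mem_set_image]
  rw [h, ncard_image_of_injective _ graft_injective, ncard_prod,
    ncard_insert_of_notMem _ c.finite_rootedSets, add_comm]
  exact fun h => h.1

theorem zero_cons_image_mem_connectedSets {c : PlanarTree} {ts : List PlanarTree}
    {S : Set (List ℕ)} (h : S ∈ c.connectedSets) :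
    List.cons 0 '' S ∈ (node (c :: ts)).unrootedSets := by
  obtain ⟨h1, r, hr, h2⟩ := h
  refine ⟨⟨?_, 0 :: r, mem_image_of_mem _ hr, ?_⟩, by simp⟩
  · rintro _ ⟨a, ha, rfl⟩
    simpa using h1 ha
  · rintro _ ⟨a, ha, rfl⟩
    refine ⟨by simpa [List.cons_prefix_cons] using (h2 a ha).1, ?_⟩
    rw [forall_address]
    refine ⟨fun b => ?_, fun b => ?_⟩
    · simpa [List.cons_prefix_cons] using (h2 a ha).2 b
    · simp

theorem shift_image_mem_unrootedSets {c : PlanarTree} {ts : List PlanarTree}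
    {S : Set (List ℕ)} (h : S ∈ (node ts).unrootedSets) :
    shift '' S ∈ (node (c :: ts)).unrootedSets := by
  obtain ⟨⟨h1, r, hr, h2⟩, h0⟩ := h
  refine ⟨⟨?_, shift r, mem_image_of_mem _ hr, ?_⟩, by simpa using h0⟩
  · rintro _ ⟨a, ha, rfl⟩
    simpa using h1 ha
  · rintro _ ⟨a, ha, rfl⟩
    refine ⟨by simpa using (h2 a ha).1, ?_⟩
    rw [forall_address]
    refine ⟨fun b => ?_, fun b => ?_⟩
    · simp
    · simpa [shift_injective.eq_iff] using (h2 a ha).2 b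

/-- The lowest vertex `r` is not the root, so all its extensions lie on the same side as `r`. Inside
the branch the root of `c` is allowed, hence `connectedSets` there and `unrootedSets` on the other
side. -/
theorem unrootedSets_cons (c : PlanarTree) (ts : List PlanarTree) :
    (node (c :: ts)).unrootedSets =
      image (List.cons 0) '' c.connectedSets ∪ image shift '' (node ts).unrootedSets := by
  ext S
  constructor
  · rintro ⟨⟨h1, r, hr, h2⟩, h0⟩
    rcases eq_zero_cons_or_eq_shift r with ⟨r, rfl⟩ | ⟨r, rfl⟩
    · left
      refine ⟨List.cons 0 ⁻¹' S, ⟨fun a ha => by simpa using h1 ha, r, hr, fun a ha => ?_⟩, ?_⟩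
      · refine ⟨by simpa [List.cons_prefix_cons] using (h2 _ ha).1, fun b hb hb' => ?_⟩
        exact (h2 _ ha).2 _ (by simpa [List.cons_prefix_cons] using hb)
          (by simpa [List.cons_prefix_cons] using hb')
      · rw [image_preimage_eq_iff]
        intro a ha
        obtain ⟨b, rfl⟩ := (h2 a ha).1
        exact ⟨r ++ b, rfl⟩
    · right
      refine ⟨shift ⁻¹' S, ⟨⟨fun a ha => by simpa using h1 ha, r, hr, fun a ha => ?_⟩, h0⟩, ?_⟩
      · refine ⟨by simpa using (h2 _ ha).1, fun b hb hb' => ?_⟩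
        exact (h2 _ ha).2 _ (by simpa using hb) (by simpa using hb')
      · rw [image_preimage_eq_iff]
        intro a ha
        rcases eq_zero_cons_or_eq_shift a with ⟨b, rfl⟩ | ⟨b, rfl⟩
        · have h3 := (h2 _ ha).1
          rw [shift_prefix_zero_cons] at h3
          subst h3
          exact absurd hr h0
        · exact ⟨b, rfl⟩
  · rintro (⟨A, hA, rfl⟩ | ⟨B, hB, rfl⟩)
    · exact zero_cons_image_mem_connectedSets hA
    · exact shift_image_mem_unrootedSets hB

theorem ncard_unrootedSets_cons (c : PlanarTree) (ts : List PlanarTree) :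
    (node (c :: ts)).unrootedSets.ncard =
      c.connectedSets.ncard + (node ts).unrootedSets.ncard := by
  rw [unrootedSets_cons, ncard_union_eq _ (c.finite_connectedSets.image _)
      ((node ts).finite_unrootedSets.image _),
    ncard_image_of_injective _ (image_injective.2 (List.cons_injective)),
    ncard_image_of_injective _ (image_injective.2 shift_injective)]
  rw [disjoint_left]
  rintro _ ⟨A, ⟨-, r, hr, -⟩, rfl⟩ ⟨B, -, h⟩
  have : 0 :: r ∈ shift '' B := h ▸ mem_image_of_mem _ hr
  obtain ⟨b, -, hb⟩ := this
  exact shift_ne_zero_cons _ _ hb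

/-! ### Childless vertices -/

/-- The addresses of the vertices of `t` without children. -/
def childless (t : PlanarTree) : Set (List ℕ) := {a | t.above a = some (node [])}

theorem finite_childless (t : PlanarTree) : t.childless.Finite :=
  t.finite_addresses.subset fun a (h : _ = _) => by simp [addresses, h]

theorem childless_nil : (node []).childless = {[]} := by
  ext a
  cases a <;> simp [childless, above, children]

theorem nil_notMem_childless (c : PlanarTree) (ts : List PlanarTree) :
    [] ∉ (node (c :: ts)).childless := by
  simp [childless]

/-- The root is removed because it is childless in `node ts` when `ts = []`, but gains a child from
the attachment. -/
theorem childless_cons (c : PlanarTree) (ts : List PlanarTree) :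
    (node (c :: ts)).childless = graft (c.childless, (node ts).childless \ {[]}) := by
  ext a
  revert a
  rw [forall_address]
  refine ⟨fun a => by simp [childless], fun a => ?_⟩
  by_cases h : a = []
  · simp [h, childless]
  · simp [h, childless, above_shift c ts h]

theorem ncard_graft {A B : Set (List ℕ)} (hA : A.Finite) (hB : B.Finite) :
    (graft (A, B)).ncard = A.ncard + B.ncard := by
  rw [graft, ncard_union_eq _ (hA.image _) (hB.image _),
    ncard_image_of_injective _ List.cons_injective, ncard_image_of_injective _ shift_injective]
  rw [disjoint_left]
  rintro _ ⟨a, -, rfl⟩ ⟨b, -, h⟩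
  exact shift_ne_zero_cons _ _ h

theorem ncard_childless_cons (c : PlanarTree) (ts : List PlanarTree) :
    (node (c :: ts)).childless.ncard = c.childless.ncard + ((node ts).childless \ {[]}).ncard := by
  rw [childless_cons, ncard_graft c.finite_childless (node ts).finite_childless.sdiff]

end PlanarTree

/-! ### Subtrees as subgraphs and as sets of addresses -/

theorem SimpleGraph.Reachable.exists_adj_boundary {V : Type*} {G : SimpleGraph V} {u v : V}
    (h : G.Reachable u v) {S : Set V} (hu : u ∈ S) (hv : v ∉ S) :
    ∃ x y, G.Adj x y ∧ x ∈ S ∧ y ∉ S := by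
  obtain ⟨p⟩ := h
  obtain ⟨d, -, h1, h2⟩ := p.exists_boundary_dart S hu hv
  exact ⟨d.fst, d.snd, d.adj, h1, h2⟩

namespace PlanarTree

open Set

variable {t : PlanarTree}

/-- The only edge leaving the part of the tree above `p` is the one just below `p`. Acyclicity and
the description of connected subgraphs both rest on this. -/
theorem eq_of_adj_of_prefix {x y : t.Vertex} (h : t.graph.Adj x y) {p : List ℕ}
    (hx : p <+: x.1) (hy : ¬ p <+: y.1) : x.1 = p ∧ ∃ i, p = y.1 ++ [i] := by
  rcases h with ⟨i, h⟩ | ⟨i, h⟩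
  · exact absurd (hx.trans ⟨[i], h.symm⟩) hy
  · rw [h, List.prefix_concat_iff] at hx
    rcases hx with rfl | hx
    · exact ⟨h, i, rfl⟩
    · exact absurd hx hy

theorem not_concat_prefix (a : List ℕ) (i : ℕ) : ¬ a ++ [i] <+: a := fun h => by
  simpa using h.length_le

/-- Every edge is a bridge: once it is deleted, nothing leaves the part above its upper end. -/
theorem isAcyclic_graph (t : PlanarTree) : t.graph.IsAcyclic := by
  have key : ∀ v w : t.Vertex, (∃ i, w.1 = v.1 ++ [i]) → t.graph.IsBridge s(w, v) := by
    rintro v w ⟨i, hi⟩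
    rw [SimpleGraph.isBridge_iff]
    intro h
    obtain ⟨x, y, hxy, hx, hy⟩ := h.exists_adj_boundary (S := {z | w.1 <+: z.1})
      (List.prefix_rfl) (by rw [mem_ofPred_eq, hi]; exact not_concat_prefix _ _)
    rw [SimpleGraph.deleteEdges_adj] at hxy
    obtain ⟨h1, j, h2⟩ := eq_of_adj_of_prefix hxy.1 hx hy
    obtain rfl : x = w := Subtype.ext h1
    obtain rfl : y = v := Subtype.ext (List.append_inj_left' (h2.symm.trans hi) rfl)
    exact hxy.2 rfl
  rw [SimpleGraph.isAcyclic_iff_forall_adj_isBridge]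
  rintro v w (h | h)
  · rw [Sym2.eq_swap]
    exact key v w h
  · exact key w v h

/-- A connected subgraph that meets the part of `t` above the vertex `w` and its complement
contains the edge below `w`. -/
theorem exists_adj_of_not_prefix {H : t.graph.Subgraph} (hH : H.coe.Connected) {w z x : t.Vertex}
    (hz : z ∈ H.verts) (hx : x ∈ H.verts) (hwz : w.1 <+: z.1) (hwx : ¬ w.1 <+: x.1) :
    ∃ v, H.Adj w v ∧ ∃ i, w.1 = v.1 ++ [i] := by
  obtain ⟨a, b, hab, ha, hb⟩ := (hH.preconnected ⟨z, hz⟩ ⟨x, hx⟩).exists_adj_boundary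
    (S := {y | w.1 <+: y.1.1}) hwz hwx
  have hab' : H.Adj a.1 b.1 := hab
  obtain ⟨h1, h2⟩ := eq_of_adj_of_prefix hab'.adj_sub ha hb
  obtain h1 : a.1 = w := Subtype.ext h1
  exact ⟨b.1, h1 ▸ hab', h2⟩

/-- Connected subgraphs are induced: the upper end of the edge lies above itself and the lower end
does not, so connectedness forces the edge into `H`. -/
theorem adj_of_adj_graph {H : t.graph.Subgraph} (hH : H.coe.Connected) {v w : t.Vertex}
    (hv : v ∈ H.verts) (hw : w ∈ H.verts) (h : t.graph.Adj v w) : H.Adj v w := by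
  have key : ∀ v w : t.Vertex, v ∈ H.verts → w ∈ H.verts → (∃ i, w.1 = v.1 ++ [i]) →
      H.Adj w v := by
    rintro v w hv hw ⟨i, hi⟩
    obtain ⟨u, h1, j, h2⟩ := exists_adj_of_not_prefix hH hw hv List.prefix_rfl
      (by rw [hi]; exact not_concat_prefix _ _)
    obtain rfl : u = v := Subtype.ext (List.append_inj_left' (h2.symm.trans hi) rfl)
    exact h1
  rcases h with h | h
  · exact (key v w hv hw h).symm
  · exact key w v hw hv h

theorem mem_addresses_of_prefix {a b : List ℕ} (h : a <+: b) (hb : b ∈ t.addresses) :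
    a ∈ t.addresses := by
  induction a generalizing t b with
  | nil => exact nil_mem_addresses t
  | cons i a ih =>
    obtain ⟨c, rfl⟩ := h
    simp only [addresses, mem_ofPred_eq, List.cons_append, above] at hb ⊢
    cases hc : t.children[i]? with
    | none => simp [hc] at hb
    | some s =>
      simp only [hc, Option.bind_some] at hb ⊢
      exact ih ⟨c, rfl⟩ hb

theorem image_verts_mem_connectedSets {H : t.graph.Subgraph} (hH : H.coe.Connected) :
    (Subtype.val '' H.verts : Set (List ℕ)) ∈ t.connectedSets := by
  -- The root of the subtree is a vertex of shortest address. A vertex of `H` not above `r` would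
  -- bring the shorter parent of `r` into `H`.
  obtain ⟨⟨r, hr⟩, hmin⟩ : ∃ r : H.verts, ∀ z : H.verts, r.1.1.length ≤ z.1.1.length := by
    have := hH.nonempty
    obtain ⟨r, -, h⟩ := WellFounded.has_min (measure fun z : H.verts => z.1.1.length).wf univ
      univ_nonempty
    exact ⟨r, fun z => not_lt.1 (h z trivial)⟩
  refine ⟨?_, r.1, mem_image_of_mem _ hr, ?_⟩
  · rintro _ ⟨v, -, rfl⟩
    exact v.2
  have hroot : ∀ z ∈ H.verts, r.1 <+: z.1 := by
    intro z hz
    by_contra h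
    obtain ⟨v, hv, i, hi⟩ := exists_adj_of_not_prefix hH hr hz List.prefix_rfl h
    have := hmin ⟨v, hv.snd_mem⟩
    simp [hi] at this
  rintro _ ⟨z, hz, rfl⟩
  refine ⟨hroot z hz, fun b hb hbz => ?_⟩
  have hbt : b ∈ t.addresses := mem_addresses_of_prefix hbz z.2
  by_cases h : b <+: r.1
  · obtain rfl : b = r.1 := h.eq_of_length (le_antisymm h.length_le hb.length_le)
    exact mem_image_of_mem _ hr
  · obtain ⟨v, hv, -⟩ := exists_adj_of_not_prefix (w := ⟨b, hbt⟩) hH hz hr hbz h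
    exact ⟨_, hv.fst_mem, rfl⟩

theorem exists_subgraph_of_mem_connectedSets {S : Set (List ℕ)} (hS : S ∈ t.connectedSets) :
    ∃ H : t.graph.Subgraph, H.coe.Connected ∧ Subtype.val '' H.verts = S := by
  obtain ⟨h1, r, hr, h2⟩ := hS
  let H : t.graph.Subgraph := (⊤ : t.graph.Subgraph).induce {v | v.1 ∈ S}
  -- Climb from `r` one letter at a time; the interval condition keeps each intermediate address in
  -- `S`.
  have hreach : ∀ a : List ℕ, ∀ h : r ++ a ∈ S,
      H.coe.Reachable ⟨⟨r, h1 hr⟩, hr⟩ ⟨⟨r ++ a, h1 h⟩, h⟩ := by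
    intro a
    induction a using List.reverseRecOn with
    | nil => simp
    | append_singleton a i ih =>
      intro h
      have h' : r ++ a ∈ S := (h2 _ h).2 _ ⟨a, rfl⟩ ⟨[i], by simp⟩
      refine (ih h').trans (SimpleGraph.Adj.reachable ?_)
      exact ⟨h', h, .inl ⟨i, (List.append_assoc _ _ _).symm⟩⟩
  refine ⟨H, ?_, ?_⟩
  · rw [SimpleGraph.connected_iff_exists_forall_reachable]
    refine ⟨⟨⟨r, h1 hr⟩, hr⟩, ?_⟩
    rintro ⟨⟨z, hz⟩, hzS : z ∈ S⟩
    obtain ⟨a, rfl⟩ := (h2 z hzS).1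
    exact hreach a hzS
  · ext a
    constructor
    · rintro ⟨v, hv, rfl⟩
      exact hv
    · exact fun ha => ⟨⟨a, h1 ha⟩, ha, rfl⟩

/-- In an acyclic graph the subgraphs that are trees are the connected ones, and these are induced,
hence determined by their vertices. -/
theorem numSubtrees_eq (t : PlanarTree) : t.numSubtrees = t.connectedSets.ncard := by
  have hinj : InjOn (fun H : t.graph.Subgraph => (Subtype.val '' H.verts : Set (List ℕ)))
      {H | H.coe.IsTree} := by
    intro H hH K hK h
    have hv : H.verts = K.verts := Subtype.val_injective.image_injective h
    refine SimpleGraph.Subgraph.ext hv ?_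
    ext x y
    refine ⟨fun h => adj_of_adj_graph hK.connected ?_ ?_ h.adj_sub,
      fun h => adj_of_adj_graph hH.connected ?_ ?_ h.adj_sub⟩
    · exact hv ▸ h.fst_mem
    · exact hv ▸ h.snd_mem
    · exact hv ▸ h.fst_mem
    · exact hv ▸ h.snd_mem
  have himage : (fun H : t.graph.Subgraph => (Subtype.val '' H.verts : Set (List ℕ))) ''
      {H | H.coe.IsTree} = t.connectedSets := by
    ext S
    constructor
    · rintro ⟨H, hH, rfl⟩
      exact image_verts_mem_connectedSets hH.connected
    · intro hS
      obtain ⟨H, hH, rfl⟩ := exists_subgraph_of_mem_connectedSets hS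
      exact ⟨H, ⟨hH, t.isAcyclic_graph.subgraph H⟩, rfl⟩
  rw [← himage, hinj.ncard_image]
  rfl

/-! ### Degrees and leaves -/

theorem ncard_image_val (s : Set t.Vertex) :
    (Subtype.val '' s : Set (List ℕ)).ncard = s.ncard :=
  ncard_image_of_injective s Subtype.val_injective

theorem above_concat (t : PlanarTree) (a : List ℕ) (i : ℕ) :
    t.above (a ++ [i]) = (t.above a).bind fun s => s.children[i]? := by
  induction a generalizing t with
  | nil => cases h : t.children[i]? <;> simp [above, h]
  | cons j a ih =>
    simp only [List.cons_append, above]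
    cases t.children[j]? <;> simp [ih]

theorem concat_mem_addresses {a : List ℕ} {s : PlanarTree} (h : t.above a = some s) {i : ℕ} :
    a ++ [i] ∈ t.addresses ↔ i < s.children.length := by
  simp [addresses, above_concat, h]

theorem image_neighborSet_of_ne_nil {v : t.Vertex} {s : PlanarTree} (h : t.above v.1 = some s)
    (h0 : v.1 ≠ []) :
    (Subtype.val '' t.graph.neighborSet v : Set (List ℕ)) =
      insert v.1.dropLast ((fun i => v.1 ++ [i]) '' Iio s.children.length) := by
  ext a
  simp only [mem_image, mem_insert_iff, mem_Iio]
  constructor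
  · rintro ⟨w, ⟨i, hi⟩ | ⟨i, hi⟩, rfl⟩
    · exact .inr ⟨i, (concat_mem_addresses h).1 (hi ▸ w.2), hi.symm⟩
    · left
      simp [hi]
  · rintro (rfl | ⟨i, hi, rfl⟩)
    · exact ⟨⟨v.1.dropLast, mem_addresses_of_prefix (List.dropLast_prefix _) v.2⟩,
        .inr ⟨v.1.getLast h0, (List.dropLast_append_getLast h0).symm⟩, rfl⟩
    · exact ⟨⟨_, (concat_mem_addresses h).2 hi⟩, .inl ⟨i, rfl⟩, rfl⟩

theorem ncard_neighborSet_of_ne_nil {v : t.Vertex} {s : PlanarTree} (h : t.above v.1 = some s)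
    (h0 : v.1 ≠ []) : (t.graph.neighborSet v).ncard = s.children.length + 1 := by
  rw [← ncard_image_val, image_neighborSet_of_ne_nil h h0,
    ncard_insert_of_notMem _ ((finite_Iio _).image _),
    ncard_image_of_injective _ fun i j hij => by simpa using hij]
  · simp [← Nat.card_coe_set_eq]
  · rintro ⟨i, -, hi⟩
    have := congrArg List.length hi
    simp at this
    omega

theorem ncard_neighborSet_of_eq_nil {v : t.Vertex} (h0 : v.1 = []) :
    (t.graph.neighborSet v).ncard = t.children.length := by
  have h : t.above v.1 = some t := by rw [h0, above_nil]
  have himage : (Subtype.val '' t.graph.neighborSet v : Set (List ℕ)) =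
      (fun i => v.1 ++ [i]) '' Iio t.children.length := by
    ext a
    simp only [mem_image, mem_Iio]
    constructor
    · rintro ⟨w, ⟨i, hi⟩ | ⟨i, hi⟩, rfl⟩
      · exact ⟨i, (concat_mem_addresses h).1 (hi ▸ w.2), hi.symm⟩
      · simp [h0] at hi
    · rintro ⟨i, hi, rfl⟩
      exact ⟨⟨_, (concat_mem_addresses h).2 hi⟩, .inl ⟨i, rfl⟩, rfl⟩
  rw [← ncard_image_val, himage, ncard_image_of_injective _ fun i j hij => by simpa using hij]
  simp [← Nat.card_coe_set_eq]

/-- A non-root vertex has one neighbour besides its children, whereas the degree of the root is its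
number of children. -/
theorem numLeaves_eq (t : PlanarTree) :
    t.numLeaves = (t.childless \ {[]}).ncard + if t.children.length = 1 then 1 else 0 := by
  have himage : (Subtype.val '' {v : t.Vertex | (t.graph.neighborSet v).ncard = 1} :
      Set (List ℕ)) = t.childless \ {[]} ∪ if t.children.length = 1 then {[]} else ∅ := by
    ext a
    constructor
    · rintro ⟨v, hv : _ = 1, rfl⟩
      by_cases h0 : v.1 = []
      · rw [ncard_neighborSet_of_eq_nil h0] at hv
        simp [h0, hv]
      · obtain ⟨s, hs⟩ := Option.isSome_iff_exists.1 v.2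
        rw [ncard_neighborSet_of_ne_nil hs h0] at hv
        left
        refine ⟨?_, h0⟩
        obtain ⟨ts⟩ := s
        obtain rfl : ts = [] := List.length_eq_zero_iff.1 (Nat.succ.inj hv)
        exact hs
    · rintro (⟨h, h0⟩ | h)
      · have ha : (t.above a).isSome := by rw [show t.above a = _ from h]; rfl
        refine ⟨⟨a, ha⟩, ?_, rfl⟩
        exact ncard_neighborSet_of_ne_nil (v := ⟨a, ha⟩) h h0
      · split_ifs at h with h1
        · obtain rfl : a = [] := h
          exact ⟨⟨[], nil_mem_addresses t⟩, (ncard_neighborSet_of_eq_nil rfl).trans h1, rfl⟩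
        · exact h.elim
  refine (ncard_image_val _).symm.trans ((congrArg ncard himage).trans ?_)
  split_ifs
  · rw [ncard_union_eq (by simp) t.finite_childless.sdiff, ncard_singleton]
  · simp

end PlanarTree

/-! ### Generating functions and the first-return decomposition -/

namespace DyckWord

open PowerSeries

/-- The generating function `∑ f(w) t ^ (l(w) / 2)` of a weight `f` on Dyck words. -/
noncomputable def genFun (f : DyckWord → ℚ) : PowerSeries ℚ :=
  PowerSeries.mk fun n => ∑ w : {w : DyckWord // w.semilength = n}, f w.1

theorem genFun_add (f g : DyckWord → ℚ) : genFun (f + g) = genFun f + genFun g := by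
  ext n
  simp [genFun, Finset.sum_add_distrib]

theorem genFun_sub (f g : DyckWord → ℚ) : genFun (f - g) = genFun f - genFun g := by
  ext n
  simp [genFun, Finset.sum_sub_distrib]

theorem genFun_sum {ι : Type*} (s : Finset ι) (f : ι → DyckWord → ℚ) :
    genFun (∑ i ∈ s, f i) = ∑ i ∈ s, genFun (f i) := by
  ext n
  simp only [genFun, coeff_mk, map_sum, Finset.sum_apply]
  rw [Finset.sum_comm]

/-- The index in the antidiagonal is determined by the semilengths of the two words, so comparing
the words avoids transport between dependent types. -/
theorem firstReturnPairs_ext {n : ℕ} {x y : Σ p : Finset.HasAntidiagonal.antidiagonal n,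
    {w : DyckWord // w.semilength = p.1.1} × {w : DyckWord // w.semilength = p.1.2}}
    (h1 : x.2.1.1 = y.2.1.1) (h2 : x.2.2.1 = y.2.2.1) : x = y := by
  obtain ⟨⟨⟨i, j⟩, h⟩, ⟨a, ha⟩, ⟨b, hb⟩⟩ := x
  obtain ⟨⟨⟨i', j'⟩, h'⟩, ⟨a', ha'⟩, ⟨b', hb'⟩⟩ := y
  change a.semilength = i at ha
  change b.semilength = j at hb
  change a'.semilength = i' at ha'
  change b'.semilength = j' at hb'
  obtain rfl : a = a' := h1
  obtain rfl : b = b' := h2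
  subst ha hb ha' hb'
  rfl

/-- The decomposition of nonempty Dyck words at the first return, graded by semilength. -/
def firstReturnEquiv (n : ℕ) : {w : DyckWord // w.semilength = n + 1} ≃
    Σ p : Finset.HasAntidiagonal.antidiagonal n, {w : DyckWord // w.semilength = p.1.1} ×
      {w : DyckWord // w.semilength = p.1.2} where
  toFun w := ⟨⟨(w.1.insidePart.semilength, w.1.outsidePart.semilength), by
    have h : w.1 ≠ 0 := by
      intro h
      have := w.2
      simp [h] at this
    have h1 := semilength_insidePart_add_semilength_outsidePart_add_one h
    have h2 := w.2
    rw [Finset.HasAntidiagonal.mem_antidiagonal]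
    dsimp only
    omega⟩, ⟨_, rfl⟩, ⟨_, rfl⟩⟩
  invFun x := ⟨x.2.1.1.nest + x.2.2.1, by
    have h := Finset.HasAntidiagonal.mem_antidiagonal.1 x.1.2
    simp only [semilength_add, semilength_nest, x.2.1.2, x.2.2.2]
    omega⟩
  left_inv w := by
    have h : w.1 ≠ 0 := by
      intro h
      have := w.2
      simp [h] at this
    exact Subtype.ext (nest_insidePart_add_outsidePart h)
  right_inv := by
    intro x
    apply firstReturnPairs_ext
    · exact (insidePart_add nest_ne_zero).trans insidePart_nest
    · exact (outsidePart_add nest_ne_zero).trans (by rw [outsidePart_nest, zero_add])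

/-- The weight whose generating function is `t` times the product of those of `f` and `g`. -/
noncomputable def firstReturnConv (f g : DyckWord → ℚ) (w : DyckWord) : ℚ :=
  open Classical in if w = 0 then 0 else f w.insidePart * g w.outsidePart

theorem nest_add_ne_zero (a b : DyckWord) : a.nest + b ≠ 0 := fun h => by
  simpa using congrArg semilength h

theorem firstReturnConv_zero (f g : DyckWord → ℚ) : firstReturnConv f g 0 = 0 := by
  simp [firstReturnConv]

theorem firstReturnConv_nest_add (f g : DyckWord → ℚ) (a b : DyckWord) :
    firstReturnConv f g (a.nest + b) = f a * g b := by
  have h := nest_add_ne_zero a b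
  rw [firstReturnConv, if_neg h, insidePart_add nest_ne_zero, insidePart_nest,
    outsidePart_add nest_ne_zero, outsidePart_nest, zero_add]

/-- The factor `X` accounts for the pair `u`, `d` enclosing the inside part. -/
theorem genFun_firstReturnConv (f g : DyckWord → ℚ) :
    genFun (firstReturnConv f g) = X * (genFun f * genFun g) := by
  ext n
  cases n with
  | zero =>
    simp only [genFun, coeff_mk, coeff_zero_X_mul]
    refine Finset.sum_eq_zero fun w _ => ?_
    have h : w.1 = 0 := by
      rw [← toList_eq_nil, ← List.length_eq_zero_iff, ← two_mul_semilength_eq_length, w.2]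
    rw [h, firstReturnConv_zero]
  | succ n =>
    rw [coeff_succ_X_mul, coeff_mul, ← Finset.sum_coe_sort]
    simp only [genFun, coeff_mk]
    rw [← (firstReturnEquiv n).symm.sum_comp, Fintype.sum_sigma]
    refine Finset.sum_congr rfl fun p _ => ?_
    rw [Fintype.sum_prod_type, Finset.sum_mul_sum]
    refine Finset.sum_congr rfl fun a _ => Finset.sum_congr rfl fun b _ => ?_
    exact firstReturnConv_nest_add f g a.1 b.1

theorem induction_nest_add {p : DyckWord → Prop} (zero : p 0)
    (nest_add : ∀ a b : DyckWord, p a → p b → p (a.nest + b)) (w : DyckWord) : p w := by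
  induction hn : w.semilength using Nat.strong_induction_on generalizing w with
  | _ n ih =>
    subst hn
    by_cases h : w = 0
    · exact h ▸ zero
    · rw [← nest_insidePart_add_outsidePart h]
      exact nest_add _ _ (ih _ (semilength_insidePart_lt h) _ rfl)
        (ih _ (semilength_outsidePart_lt h) _ rfl)

/-- A weight on Dyck words is determined by its values on the empty word and on words
`u a d b`. -/
theorem funext_nest_add {f g : DyckWord → ℚ} (zero : f 0 = g 0)
    (nest_add : ∀ a b : DyckWord, f (a.nest + b) = g (a.nest + b)) : f = g := by
  ext w
  exact induction_nest_add (p := fun w => f w = g w) zero (fun a b _ _ => nest_add a b) w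

/-- The indicator function of the empty word. -/
noncomputable def unitWeight (w : DyckWord) : ℚ := open Classical in if w = 0 then 1 else 0

theorem unitWeight_zero : unitWeight 0 = 1 := by simp [unitWeight]

theorem unitWeight_nest_add (a b : DyckWord) : unitWeight (a.nest + b) = 0 := by
  have h := nest_add_ne_zero a b
  rw [unitWeight, if_neg h]

theorem genFun_unitWeight : genFun unitWeight = 1 := by
  ext n
  rw [genFun, coeff_mk, coeff_one]
  split_ifs with hn
  · subst hn
    rw [Fintype.sum_eq_single ⟨0, rfl⟩, unitWeight_zero]
    intro w hw
    have h : w.1 = 0 := by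
      rw [← toList_eq_nil, ← List.length_eq_zero_iff, ← two_mul_semilength_eq_length, w.2]
    exact absurd (Subtype.ext h) hw
  · refine Finset.sum_eq_zero fun w _ => if_neg fun h => hn ?_
    rw [← w.2, h, semilength_zero]

end DyckWord

/-! ### Leaf and subtree recursions on Dyck words -/

namespace DyckWord

open PowerSeries

theorem planarTree_zero : (0 : DyckWord).planarTree = .node [] := by
  rw [planarTree]
  simp

theorem planarTree_nest_add (a b : DyckWord) :
    (a.nest + b).planarTree = .node (a.planarTree :: b.planarTree.children) := by
  have h := nest_add_ne_zero a b
  rw [planarTree, dif_neg h]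
  dsimp only
  rw [insidePart_add nest_ne_zero, insidePart_nest,
    outsidePart_add nest_ne_zero, outsidePart_nest, zero_add]

theorem node_children (t : PlanarTree) : .node t.children = t := by
  cases t
  rfl

/-- The number of leaves of the tree of `w` other than the root. -/
noncomputable def leafNum (w : DyckWord) : ℕ := (w.planarTree.childless \ {[]}).ncard

/-- The number of subtrees of the tree of `w` that contain the root. -/
noncomputable def rooted (w : DyckWord) : ℚ := w.planarTree.rootedSets.ncard

/-- The number of subtrees of the tree of `w` that do not contain the root. -/
noncomputable def unrooted (w : DyckWord) : ℚ := w.planarTree.unrootedSets.ncard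

theorem leafNum_zero : leafNum 0 = 0 := by
  simp [leafNum, planarTree_zero, PlanarTree.childless_nil]

theorem rooted_zero : rooted 0 = 1 := by
  rw [rooted, planarTree_zero, PlanarTree.ncard_rootedSets_nil, Nat.cast_one]

theorem unrooted_zero : unrooted 0 = 0 := by
  rw [unrooted, planarTree_zero, PlanarTree.unrootedSets_nil, Set.ncard_empty, Nat.cast_zero]

theorem rooted_nest_add (a b : DyckWord) : rooted (a.nest + b) = (1 + rooted a) * rooted b := by
  rw [rooted, planarTree_nest_add, PlanarTree.ncard_rootedSets_cons, node_children, Nat.cast_mul,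
    Nat.cast_add, Nat.cast_one, rooted, rooted]

theorem unrooted_nest_add (a b : DyckWord) :
    unrooted (a.nest + b) = rooted a + unrooted a + unrooted b := by
  rw [unrooted, planarTree_nest_add, PlanarTree.ncard_unrootedSets_cons, node_children,
    PlanarTree.ncard_connectedSets, Nat.cast_add, Nat.cast_add, rooted, unrooted, unrooted]

open Classical in
theorem ncard_childless_planarTree (w : DyckWord) :
    w.planarTree.childless.ncard = if w = 0 then 1 else leafNum w := by
  split_ifs with h
  · simp [h, planarTree_zero, PlanarTree.childless_nil]
  · rw [leafNum, Set.sdiff_singleton_eq_self]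
    rw [← nest_insidePart_add_outsidePart h, planarTree_nest_add]
    exact PlanarTree.nil_notMem_childless _ _

open Classical in
-- When `a` is empty, the upper end of the new edge is itself a leaf, although `leafNum 0 = 0`.
theorem leafNum_nest_add (a b : DyckWord) :
    leafNum (a.nest + b) = (if a = 0 then 1 else leafNum a) + leafNum b := by
  rw [leafNum, planarTree_nest_add, Set.sdiff_singleton_eq_self
    (PlanarTree.nil_notMem_childless _ _), PlanarTree.ncard_childless_cons, node_children,
    ncard_childless_planarTree, ← leafNum]

theorem leafNum_eq_zero {w : DyckWord} : leafNum w = 0 ↔ w = 0 := by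
  refine ⟨?_, fun h => h ▸ leafNum_zero⟩
  refine induction_nest_add (p := fun w => leafNum w = 0 → w = 0) (fun _ => rfl) ?_ w
  intro a b ha hb h
  rw [leafNum_nest_add] at h
  split_ifs at h with h0
  · omega
  · exact absurd (ha (by omega)) h0

/-! ### Grading by the number of non-root leaves -/

/-- The restriction of a weight to the Dyck words whose trees have `k` leaves besides the root. -/
noncomputable def level (k : ℕ) (f : DyckWord → ℚ) (w : DyckWord) : ℚ :=
  if leafNum w = k then f w else 0

theorem level_add (k : ℕ) (f g : DyckWord → ℚ) : level k (f + g) = level k f + level k g := by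
  ext w
  by_cases h : leafNum w = k <;> simp [level, h]

theorem level_zero (f : DyckWord → ℚ) : level 0 f = fun w => f 0 * unitWeight w := by
  ext w
  by_cases h : w = 0
  · simp [level, leafNum_eq_zero, h, unitWeight]
  · simp [level, leafNum_eq_zero, h, unitWeight]

theorem level_unitWeight {k : ℕ} (hk : k ≠ 0) : level k unitWeight = 0 := by
  ext w
  by_cases h : w = 0
  · simp [level, h, leafNum_zero, hk.symm]
  · simp [level, h, unitWeight]

theorem genFun_level_zero (f : DyckWord → ℚ) : genFun (level 0 f) = C (f 0) := by
  rw [level_zero, ← mul_one (C (f 0)), ← genFun_unitWeight]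
  ext n
  simp [genFun, Finset.mul_sum]

/-- The first term collects the words with empty inside part, which uses up one leaf; the sum runs
over the leaf number `i ≥ 1` of a nonempty inside part. -/
theorem level_firstReturnConv {k : ℕ} (hk : k ≠ 0) (f g : DyckWord → ℚ) :
    level k (firstReturnConv f g) = firstReturnConv (level 0 f) (level (k - 1) g) +
      ∑ i ∈ Finset.Icc 1 k, firstReturnConv (level i f) (level (k - i) g) := by
  refine funext_nest_add ?_ fun a b => ?_
  · simp [level, firstReturnConv_zero]
  · rw [level, leafNum_nest_add, Pi.add_apply, Finset.sum_apply]
    simp only [firstReturnConv_nest_add]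
    by_cases h : a = 0
    · rw [Finset.sum_eq_zero, if_pos h]
      · have h1 : 1 + leafNum b = k ↔ leafNum b = k - 1 := by omega
        simp [level, h, leafNum_zero, h1]
      · intro i hi
        have := (Finset.mem_Icc.1 hi).1
        rw [level, if_neg (by rw [h, leafNum_zero]; omega), zero_mul]
    · rw [if_neg h, level, if_neg (fun h' => h (leafNum_eq_zero.1 h')), zero_mul, zero_add]
      have h0 : leafNum a ≠ 0 := fun h' => h (leafNum_eq_zero.1 h')
      split_ifs with h1
      · rw [Finset.sum_eq_single (leafNum a)]
        · rw [level, level, if_pos rfl, if_pos (by omega)]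
        · intro i _ hi
          rw [level, if_neg hi.symm, zero_mul]
        · intro h2
          exact absurd (Finset.mem_Icc.2 ⟨by omega, by omega⟩) h2
      · refine (Finset.sum_eq_zero fun i hi => ?_).symm
        have := (Finset.mem_Icc.1 hi).2
        by_cases h2 : leafNum a = i
        · rw [level, level, if_neg (c := leafNum b = _) (by omega), mul_zero]
        · rw [level, if_neg h2, zero_mul]

/-! ### Algebraicity of each level -/

/-- The subalgebra of algebraic power series. -/
noncomputable abbrev algebraicSeries : Subalgebra (Polynomial ℚ) (PowerSeries ℚ) :=
  Subalgebra.algebraicClosure (Polynomial ℚ) (PowerSeries ℚ)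

theorem X_mem_algebraicSeries : (X : PowerSeries ℚ) ∈ algebraicSeries := by
  have h := algebraicSeries.algebraMap_mem Polynomial.X
  rwa [show algebraMap (Polynomial ℚ) (PowerSeries ℚ) Polynomial.X = X by
    simp [PowerSeries.algebraMap_apply']] at h

theorem C_mem_algebraicSeries (q : ℚ) : (C q : PowerSeries ℚ) ∈ algebraicSeries := by
  have h := algebraicSeries.algebraMap_mem (Polynomial.C q)
  rwa [show algebraMap (Polynomial ℚ) (PowerSeries ℚ) (Polynomial.C q) = C q by
    simp [PowerSeries.algebraMap_apply']] at h

theorem mem_algebraicSeries_of_sub_X_mul_mem {z : PowerSeries ℚ}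
    (h : z - X * z ∈ algebraicSeries) : z ∈ algebraicSeries := by
  have h0 : (1 - X : PowerSeries ℚ) ≠ 0 := fun h => by
    simpa using congrArg constantCoeff h
  have h1 : (1 - X : PowerSeries ℚ) ∈ algebraicSeries :=
    sub_mem (one_mem _) X_mem_algebraicSeries
  refine IsAlgebraic.of_mul (mem_nonZeroDivisors_of_ne_zero h0) h1 ?_
  rwa [sub_mul, one_mul]

/-- The only contribution from level `k` itself is the summand `i = k`, where `g` enters through
level `0`, that is, through the constant `g 0`. Everything else involves levels below `k`. -/
theorem genFun_level_firstReturnConv_sub_mem {k : ℕ} (hk : k ≠ 0) {f g : DyckWord → ℚ}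
    (hf : ∀ i < k, genFun (level i f) ∈ algebraicSeries)
    (hg : ∀ i < k, genFun (level i g) ∈ algebraicSeries) :
    genFun (level k (firstReturnConv f g)) - X * (genFun (level k f) * C (g 0)) ∈
      algebraicSeries := by
  have h : genFun (level k (firstReturnConv f g)) - X * (genFun (level k f) * C (g 0)) =
      X * (genFun (level 0 f) * genFun (level (k - 1) g)) +
        ∑ i ∈ Finset.Ico 1 k, X * (genFun (level i f) * genFun (level (k - i) g)) := by
    rw [level_firstReturnConv hk, genFun_add, genFun_sum,
      ← Finset.sum_Ico_add_eq_sum_Icc (Nat.one_le_iff_ne_zero.2 hk)]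
    simp only [genFun_firstReturnConv, Nat.sub_self, genFun_level_zero g]
    ring
  rw [h]
  refine add_mem (mul_mem X_mem_algebraicSeries (mul_mem (hf 0 (by omega)) (hg _ (by omega))))
    (sum_mem fun i hi => mul_mem X_mem_algebraicSeries ?_)
  have := Finset.mem_Ico.1 hi
  exact mul_mem (hf i (by omega)) (hg _ (by omega))

theorem one_eq : (1 : DyckWord → ℚ) = unitWeight + firstReturnConv 1 1 :=
  funext_nest_add (by simp [unitWeight_zero, firstReturnConv_zero])
    fun a b => by simp [unitWeight_nest_add, firstReturnConv_nest_add]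

theorem rooted_eq : rooted = unitWeight + firstReturnConv (1 + rooted) rooted :=
  funext_nest_add (by simp [unitWeight_zero, firstReturnConv_zero, rooted_zero])
    fun a b => by simp [unitWeight_nest_add, firstReturnConv_nest_add, rooted_nest_add]

theorem unrooted_eq :
    unrooted = firstReturnConv (rooted + unrooted) 1 + firstReturnConv 1 unrooted :=
  funext_nest_add (by simp [firstReturnConv_zero, unrooted_zero])
    fun a b => by simp [firstReturnConv_nest_add, unrooted_nest_add]

/-- At a given level the order is `1`, `rooted`, `unrooted`: each equation involves its own unknown,
with coefficient `1 - X`, and the preceding weight. -/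
theorem genFun_level_mem (k : ℕ) :
    genFun (level k 1) ∈ algebraicSeries ∧ genFun (level k rooted) ∈ algebraicSeries ∧
      genFun (level k unrooted) ∈ algebraicSeries := by
  induction k using Nat.strong_induction_on with
  | _ k ih =>
    by_cases hk : k = 0
    · subst hk
      simp only [genFun_level_zero]
      exact ⟨C_mem_algebraicSeries _, C_mem_algebraicSeries _, C_mem_algebraicSeries _⟩
    have ih1 : ∀ i < k, genFun (level i 1) ∈ algebraicSeries := fun i hi => (ih i hi).1
    have ihr : ∀ i < k, genFun (level i rooted) ∈ algebraicSeries := fun i hi => (ih i hi).2.1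
    have ihu : ∀ i < k, genFun (level i unrooted) ∈ algebraicSeries := fun i hi => (ih i hi).2.2
    have h1 : genFun (level k 1) ∈ algebraicSeries := by
      apply mem_algebraicSeries_of_sub_X_mul_mem
      have h := genFun_level_firstReturnConv_sub_mem hk ih1 ih1
      have e : level k 1 = level k (firstReturnConv 1 1) := by
        conv_lhs => rw [one_eq, level_add, level_unitWeight hk, zero_add]
      rwa [← e, Pi.one_apply, map_one, mul_one] at h
    have hr : genFun (level k rooted) ∈ algebraicSeries := by
      apply mem_algebraicSeries_of_sub_X_mul_mem
      have h := genFun_level_firstReturnConv_sub_mem hk (f := 1 + rooted) (fun i hi => by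
        rw [level_add, genFun_add]
        exact add_mem (ih1 i hi) (ihr i hi)) ihr
      have e : level k rooted = level k (firstReturnConv (1 + rooted) rooted) := by
        conv_lhs => rw [rooted_eq, level_add, level_unitWeight hk, zero_add]
      rw [← e, rooted_zero, map_one, mul_one, level_add, genFun_add] at h
      -- The factor `1 + rooted` also produces `X` times level `k` of the weight `1`, already known
      -- to be algebraic.
      convert add_mem h (mul_mem X_mem_algebraicSeries h1) using 1
      ring
    refine ⟨h1, hr, ?_⟩
    apply mem_algebraicSeries_of_sub_X_mul_mem
    have h := genFun_level_firstReturnConv_sub_mem hk (f := rooted + unrooted) (fun i hi => by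
      rw [level_add, genFun_add]
      exact add_mem (ihr i hi) (ihu i hi)) ih1
    have h' := genFun_level_firstReturnConv_sub_mem hk ih1 ihu
    have e : genFun (level k unrooted) =
        genFun (level k (firstReturnConv (rooted + unrooted) 1)) +
          genFun (level k (firstReturnConv 1 unrooted)) := by
      conv_lhs => rw [unrooted_eq, level_add, genFun_add]
    -- Since `unrooted 0 = 0`, the second convolution has no contribution from level `k`.
    rw [unrooted_zero, map_zero, mul_zero, mul_zero, sub_zero] at h'
    rw [Pi.one_apply, map_one, mul_one, level_add, genFun_add] at h
    convert add_mem (add_mem h h') (mul_mem X_mem_algebraicSeries hr) using 1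
    linear_combination e

/-! ### Correction for a root of degree one -/

theorem numSubtrees_planarTree (w : DyckWord) :
    (w.planarTree.numSubtrees : ℚ) = rooted w + unrooted w := by
  rw [PlanarTree.numSubtrees_eq, PlanarTree.ncard_connectedSets, Nat.cast_add, rooted, unrooted]

theorem sum_range_level (l : ℕ) (f : DyckWord → ℚ) (w : DyckWord) :
    ∑ k ∈ Finset.range (l + 1), level k f w = if leafNum w ≤ l then f w else 0 := by
  simp [level, Finset.sum_ite_eq]

theorem children_planarTree_eq_nil {w : DyckWord} : w.planarTree.children = [] ↔ w = 0 := by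
  refine induction_nest_add (p := fun w => w.planarTree.children = [] ↔ w = 0) ?_ ?_ w
  · simp [planarTree_zero, PlanarTree.children]
  · intro a b _ _
    have h := nest_add_ne_zero a b
    simp [planarTree_nest_add, PlanarTree.children, h]

/-- The trees with `l` leaves besides the root in which the root is a leaf as well consist of an
edge from the root to a tree with `l` leaves besides its own root. -/
theorem subtreeCount_eq {l : ℕ} (hl : 2 ≤ l) :
    (fun w => (subtreeCount l w : ℚ)) =
      ∑ k ∈ Finset.range (l + 1), level k (rooted + unrooted) -
        firstReturnConv (level l (1 + rooted + (rooted + unrooted))) unitWeight := by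
  refine funext_nest_add ?_ fun a b => ?_
  · have h0 : (0 : DyckWord).planarTree.numLeaves = 0 := by
      rw [PlanarTree.numLeaves_eq, ← leafNum, leafNum_zero, planarTree_zero]
      simp [PlanarTree.children]
    rw [Pi.sub_apply, Finset.sum_apply, sum_range_level, firstReturnConv_zero, leafNum_zero,
      if_pos (Nat.zero_le l), sub_zero, subtreeCount, h0, if_pos (Nat.zero_le l),
      numSubtrees_planarTree, Pi.add_apply]
  · rw [Pi.sub_apply, Finset.sum_apply, sum_range_level, firstReturnConv_nest_add, subtreeCount,
      PlanarTree.numLeaves_eq, ← leafNum, Nat.cast_ite, numSubtrees_planarTree, Nat.cast_zero,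
      Pi.add_apply]
    have hlen : (a.nest + b).planarTree.children.length = 1 ↔ b = 0 := by
      simp [planarTree_nest_add, PlanarTree.children, ← children_planarTree_eq_nil]
    by_cases hb : b = 0
    · rw [if_pos (hlen.2 hb), hb, unitWeight_zero, mul_one, level]
      -- For empty `a` the two leaf numbers are `1` and `0`; both sides are then false because `l ≥
      -- 2`.
      have h2 : leafNum (a.nest + 0) = l ↔ leafNum a = l := by
        rw [leafNum_nest_add, leafNum_zero]
        split_ifs with h
        · rw [h, leafNum_zero]
          omega
        · rfl
      have h3 : rooted (a.nest + 0) + unrooted (a.nest + 0) =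
          (1 + rooted + (rooted + unrooted)) a := by
        rw [rooted_nest_add, unrooted_nest_add, rooted_zero, unrooted_zero]
        simp
      rw [h3]
      -- The root is a leaf here. If `leafNum a = l` there are `l + 1` leaves in all, and the
      -- correction cancels the term; otherwise counting the root does not affect the comparison
      -- with `l`.
      by_cases h4 : leafNum a = l
      · rw [if_pos h4, h2.2 h4, if_pos le_rfl, if_neg (by omega), sub_self]
      · have h5 := mt h2.1 h4
        rw [if_neg h4, sub_zero]
        exact if_congr (by omega) rfl rfl
    · rw [if_neg (mt hlen.1 hb), add_zero, unitWeight, if_neg hb, mul_zero, sub_zero]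

theorem subtreeSeries_mem_algebraicSeries {l : ℕ} (hl : 2 ≤ l) :
    subtreeSeries l ∈ algebraicSeries := by
  have h : subtreeSeries l = genFun fun w => (subtreeCount l w : ℚ) := rfl
  have hN : ∀ k, genFun (level k (rooted + unrooted)) ∈ algebraicSeries := fun k => by
    rw [level_add, genFun_add]
    exact add_mem (genFun_level_mem k).2.1 (genFun_level_mem k).2.2
  rw [h, subtreeCount_eq hl, genFun_sub, genFun_sum, genFun_firstReturnConv, genFun_unitWeight,
    mul_one, level_add, genFun_add, level_add, genFun_add]
  exact sub_mem (sum_mem fun k _ => hN k) (mul_mem X_mem_algebraicSeries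
    (add_mem (add_mem (genFun_level_mem l).1 (genFun_level_mem l).2.1) (hN l)))

end DyckWord

/-- The generating function `H_l(t)` is algebraic: it satisfies a nonzero polynomial equation
whose coefficients are polynomials in `t` over `ℚ` (equivalently, after clearing denominators,
rational functions in `t` over `ℚ`). -/
theorem mainTheorem7 (l : ℕ) (hl : 2 ≤ l) :
    IsAlgebraic (Polynomial ℚ) (DyckWord.subtreeSeries l) := by
  exact DyckWord.subtreeSeries_mem_algebraicSeries hl
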